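/- Let $n,r\ge 0$ be integers. Let $\mathrm{GL}(n,\mathbb C)$ act on $\mathfrak{gl}(n,\mathbb C)^{\times r}$ (all $r$-tuples of complex $n\times n$ matrices), and $\mathrm{SL}(n,\mathbb C)$ on $\mathrm{SL}(n,\mathbb C)^{\times r}$, by simultaneous conjugation $g\cdot(X_1,\dots,X_r)=(gX_1g^{-1},\dots,gX_rg^{-1})$. For an affine variety $Y$ with an action of a group $G$, let $\mathbb C[Y/\!\!/G]=\mathbb C[Y]^G$ denote the ring of $G$-invariant polynomial functions on $Y$. For an $n\times n$ matrix $X$ define recursively $$C^0(X)=1,\qquad C^m(X)=\frac1m\sum_{k=1}^m(-1)^{k+1}C^{m-k}(X)\,\mathrm{tr}(X^k)\quad(m\ge1),$$ and put $$P(X)=(-1)^{n+1}n+\sum_{k=1}^{n-1}(-1)^{n+k+1}C^{n-k}(X)\,\mathrm{tr}(X^k).$$ Then restriction of functions from $\mathfrak{gl}(n,\mathbb C)^{\times r}$ to $\mathrm{SL}(n,\mathbb C)^{\times r}$ induces an isomorphism of $\mathbb C$-algebras $$\mathbb C[\mathfrak{gl}(n,\mathbb C)^{\times r}/\!\!/\mathrm{GL}(n,\mathbb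 C)]\,/\,\mathfrak I\;\cong\;\mathbb C[\mathrm{SL}(n,\mathbb C)^{\times r}/\!\!/\mathrm{SL}(n,\mathbb C)],$$ where $\mathfrak I=\big(\mathrm{tr}(X_1^n)-P(X_1),\dots,\mathrm{tr}(X_r^n)-P(X_r)\big)$ is the ideal generated in $\mathbb C[\mathfrak{gl}(n,\mathbb C)^{\times r}/\!\!/\mathrm{GL}(n,\mathbb C)]$. Moreover, for every complex $n\times n$ matrix $X$, $$P(X)=\mathrm{tr}(X^n)+(-1)^n\,n\,(\det X-1)\qquad\text{and}\qquad \det(tI-X)=\sum_{k=0}^n(-1)^{n-k}C^{n-k}(X)\,t^k,$$ and $P(X)$ is a polynomial (the same for all $X$) in $\mathrm{tr}(X),\dots,\mathrm{tr}(X^{n-1})$, as well as a polynomial in the coefficients of the characteristic polynomial of $X$. -/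

import Mathlib

namespace MatrixInvariants

open Matrix

/-- The ring of polynomial functions on a set `Y` that is placed in affine space by the coordinate
functions `c s : Y → ℂ`, `s ∈ σ`: the functions on `Y` that are polynomials in the `c s`. -/
noncomputable def coordinateRing {σ Y : Type} (c : σ → Y → ℂ) : Subalgebra ℂ (Y → ℂ) :=
  (MvPolynomial.aeval c : MvPolynomial σ ℂ →ₐ[ℂ] (Y → ℂ)).range

/-- The functions on `Y` that are invariant under an action of `G` on `Y`, given as a map. -/
def invariantFunctions {G Y : Type} (act : G → Y → Y) : Subalgebra ℂ (Y → ℂ) where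
  carrier := {f | ∀ g y, f (act g y) = f y}
  mul_mem' hf hg a y := by simp [hf a y, hg a y]
  add_mem' hf hg a y := by simp [hf a y, hg a y]
  algebraMap_mem' _ _ _ := rfl

/-- `gl(n, ℂ)^r`. -/
abbrev GlTuple (n r : ℕ) : Type := Fin r → Matrix (Fin n) (Fin n) ℂ

/-- `SL(n, ℂ)^r`. -/
abbrev SLTuple (n r : ℕ) : Type := Fin r → SpecialLinearGroup (Fin n) ℂ

/-- The matrix entry `x_{ij}^k` as a function on `gl(n, ℂ)^r`, for `s = (k, i, j)`. -/
def glCoord (n r : ℕ) (s : Fin r × Fin n × Fin n) (X : GlTuple n r) : ℂ :=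
  X s.1 s.2.1 s.2.2

/-- The matrix entry `x_{ij}^k` as a function on `SL(n, ℂ)^r`, for `s = (k, i, j)`. -/
def slCoord (n r : ℕ) (s : Fin r × Fin n × Fin n) (X : SLTuple n r) : ℂ :=
  (X s.1 : Matrix (Fin n) (Fin n) ℂ) s.2.1 s.2.2

/-- Simultaneous conjugation of `GL(n, ℂ)` on `gl(n, ℂ)^r`. -/
def glConj (n r : ℕ) (g : GL (Fin n) ℂ) (X : GlTuple n r) : GlTuple n r :=
  fun k => (g : Matrix (Fin n) (Fin n) ℂ) * X k * ((g⁻¹ : GL (Fin n) ℂ) : Matrix (Fin n) (Fin n) ℂ)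

/-- Simultaneous conjugation of `SL(n, ℂ)` on `SL(n, ℂ)^r`. -/
def slConj (n r : ℕ) (g : SpecialLinearGroup (Fin n) ℂ) (X : SLTuple n r) : SLTuple n r :=
  fun k => g * X k * g⁻¹

/-- `ℂ[gl(n, ℂ)^r // GL(n, ℂ)]`, the ring of `GL(n, ℂ)`-invariant polynomial functions on
`gl(n, ℂ)^r`. -/
noncomputable abbrev GlQuotientRing (n r : ℕ) : Subalgebra ℂ (GlTuple n r → ℂ) :=
  coordinateRing (glCoord n r) ⊓ invariantFunctions (glConj n r)

/-- `ℂ[SL(n, ℂ)^r // SL(n, ℂ)]`, the ring of `SL(n, ℂ)`-invariant polynomial functions on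
`SL(n, ℂ)^r`. -/
noncomputable abbrev SLQuotientRing (n r : ℕ) : Subalgebra ℂ (SLTuple n r → ℂ) :=
  coordinateRing (slCoord n r) ⊓ invariantFunctions (slConj n r)

/-- The polynomials `C_0^m` in a sequence `p` (in the application, `p k = tr(X^k)`):
`C_0^0 = 1` and `C_0^m = (1/m) ∑_{k=1}^m (-1)^{k+1} C_0^{m-k} p_k`; the sum below is over `k - 1`. -/
noncomputable def newtonC {A : Type} [CommRing A] [Algebra ℂ A] (p : ℕ → A) : ℕ → A
  | 0 => 1
  | m + 1 => ((m : ℂ) + 1)⁻¹ •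
      ∑ k : Fin (m + 1), (-1) ^ (k : ℕ) * newtonC p (m - (k : ℕ)) * p ((k : ℕ) + 1)
  termination_by m => m
  decreasing_by omega

/-- `P = (-1)^{n+1} n + ∑_{k=1}^{n-1} (-1)^{n+k+1} C_0^{n-k} p_k`. -/
noncomputable def newtonP {A : Type} [CommRing A] [Algebra ℂ A] (n : ℕ) (p : ℕ → A) : A :=
  (-1) ^ (n + 1) * (n : A) +
    ∑ k ∈ Finset.Ico 1 n, (-1) ^ (n + k + 1) * newtonC p (n - k) * p k

/-- The sequence `k ↦ tr(X^k)` of a matrix. -/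
noncomputable def powTrace {n : ℕ} (X : Matrix (Fin n) (Fin n) ℂ) (k : ℕ) : ℂ := (X ^ k).trace

theorem powTrace_mem (n r : ℕ) (k : Fin r) (m : ℕ) :
    (fun X : GlTuple n r => powTrace (X k) m) ∈ GlQuotientRing n r := by
  refine ⟨?_, ?_⟩
  · have h : ∀ m (i j : Fin n),
        (fun X : GlTuple n r => ((X k) ^ m) i j) ∈ coordinateRing (glCoord n r) := by
      intro m
      induction m with
      | zero =>
        intro i j
        exact (coordinateRing (glCoord n r)).algebraMap_mem
          ((1 : Matrix (Fin n) (Fin n) ℂ) i j)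
      | succ m ih =>
        intro i j
        have : (fun X : GlTuple n r => ((X k) ^ (m + 1)) i j) =
            ∑ l, (fun X : GlTuple n r => ((X k) ^ m) i l) * glCoord n r (k, l, j) := by
          funext X
          simp [pow_succ, Matrix.mul_apply, glCoord]
        rw [this]
        exact Subalgebra.sum_mem _ fun l _ => Subalgebra.mul_mem _ (ih i l)
          ⟨MvPolynomial.X (k, l, j), by simp⟩
    have e : (fun X : GlTuple n r => powTrace (X k) m) =
        ∑ i, fun X : GlTuple n r => ((X k) ^ m) i i := by
      funext X
      simp [powTrace, Matrix.trace]
    rw [e]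
    exact Subalgebra.sum_mem _ fun i _ => h m i i
  · intro g X
    simp only [glConj, powTrace]
    rw [Units.conj_pow, Matrix.trace_units_conj]

/-- `tr(X_k^m)` as an element of `ℂ[gl(n, ℂ)^r // GL(n, ℂ)]`. -/
noncomputable def tracePow (n r : ℕ) (k : Fin r) (m : ℕ) : GlQuotientRing n r :=
  ⟨fun X => powTrace (X k) m, powTrace_mem n r k m⟩

/-- The ideal `(tr(X_1^n) - P(X_1), …, tr(X_r^n) - P(X_r))` of `ℂ[gl(n, ℂ)^r // GL(n, ℂ)]`. -/
noncomputable def unimodularIdeal (n r : ℕ) : Ideal (GlQuotientRing n r) :=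
  Ideal.span (Set.range fun k : Fin r => tracePow n r k n - newtonP n (tracePow n r k))

end MatrixInvariants

/-! Newton's identities for the eigenvalues identify `newtonC (powTrace X) m` with their elementary
symmetric functions, so `tr(X^n) - P(X)` equals `-(-1)^n n (det X - 1)`. For `n ≠ 0` the ideal is
thus generated by the `det X_k - 1`, and it remains to compute the kernel and image of restriction.

Both follow from one normalization, with no Reynolds operator. Multiply each multihomogeneous
component of a polynomial function by powers of the `det X_k`; this changes neither its values on
`SL^r` nor, for invariants, its class modulo the ideal. The exponents can be chosen so that all
degrees in `X_k` lie in `[nM, nM + n)` (`exists_balanced`). Such a function vanishes if it vanishes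
on `SL^r` (`IsBalanced.eq_zero`): scaling by `n`-th roots of unity preserves `SL^r`, and `n` roots
determine a polynomial of degree below `n`.

An invariant in the kernel is therefore congruent to a balanced function that is zero. Conversely, a
balanced extension of an `SL`-invariant function is unique, hence itself invariant. -/

namespace MatrixInvariants

open Matrix

/-! ### Newton's identities: power traces, characteristic polynomial and determinant. -/

section Newton

/-- The determinant of a polynomial in `X` is the product of its values at the eigenvalues. -/
theorem det_aeval_eq_prod_roots_charpoly {n : ℕ} (X : Matrix (Fin n) (Fin n) ℂ)
    (q : Polynomial ℂ) :
    (Polynomial.aeval X q).det = (X.charpoly.roots.map fun a => q.eval a).prod := by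
  have hcard : X.charpoly.roots.card = n := by
    rw [(Polynomial.splits_iff_card_roots.mp (IsAlgClosed.splits X.charpoly)),
      charpoly_natDegree_eq_dim, Fintype.card_fin]
  have hlin : ∀ b : ℂ, (X - scalar (Fin n) b).det =
      (X.charpoly.roots.map fun a => a - b).prod := by
    intro b
    have h := congrArg (Polynomial.eval b)
      ((IsAlgClosed.splits X.charpoly).eq_prod_roots_of_monic X.charpoly_monic)
    rw [eval_charpoly, Polynomial.eval_multiset_prod, Multiset.map_map] at h
    have hneg : X - scalar (Fin n) b = -(scalar (Fin n) b - X) := by abel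
    rw [hneg, det_neg, h, Fintype.card_fin]
    have : (X.charpoly.roots.map fun a => a - b) =
        X.charpoly.roots.map fun a => (-1) * (b - a) := by
      refine Multiset.map_congr rfl fun a _ => by ring
    rw [this, Multiset.prod_map_mul, Multiset.map_const', Multiset.prod_replicate, hcard]
    simp
  -- `q` splits over `ℂ`, so multiplicativity of both sides reduces the claim to the linear factors
  -- in `hlin`.
  have hs := (IsAlgClosed.splits q).eq_prod_roots
  have hmul : ∀ s : Multiset ℂ,
      (Polynomial.aeval X (s.map fun b => Polynomial.X - Polynomial.C b).prod).det =
        (X.charpoly.roots.map fun a =>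
          (s.map fun b => Polynomial.X - Polynomial.C b).prod.eval a).prod := by
    intro s
    induction s using Multiset.induction with
    | empty => simp
    | cons b s ih =>
      simp only [Multiset.map_cons, Multiset.prod_cons, map_mul, det_mul, ih, Polynomial.eval_mul,
        Multiset.prod_map_mul, map_sub, Polynomial.aeval_X, Polynomial.aeval_C,
        Polynomial.eval_sub, Polynomial.eval_X, Polynomial.eval_C]
      rw [← hlin b]
      rfl
  rw [hs]
  simp only [map_mul, det_mul, hmul, Polynomial.eval_mul, Multiset.prod_map_mul,
    Polynomial.aeval_C, Polynomial.eval_C, Multiset.map_const', Multiset.prod_replicate, hcard]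
  congr 1
  simp [algebraMap_eq_diagonal]

/-- Applying the determinant formula to `s - T^k` for every `s` gives the characteristic polynomial
of `X ^ k`, and hence its eigenvalues with multiplicity. -/
theorem trace_pow_eq_sum_roots_charpoly {n : ℕ} (X : Matrix (Fin n) (Fin n) ℂ) (k : ℕ) :
    (X ^ k).trace = (X.charpoly.roots.map fun a => a ^ k).sum := by
  have h : (X ^ k).charpoly =
      ((X.charpoly.roots.map fun a => a ^ k).map
        fun b => Polynomial.X - Polynomial.C b).prod := by
    refine Polynomial.funext fun s => ?_
    have := det_aeval_eq_prod_roots_charpoly X (Polynomial.C s - Polynomial.X ^ k)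
    rw [eval_charpoly, Polynomial.eval_multiset_prod, Multiset.map_map, Multiset.map_map]
    simpa [algebraMap_eq_diagonal, Function.comp_def, Pi.algebraMap_def] using this
  rw [trace_eq_sum_roots_charpoly, h, Polynomial.roots_multiset_prod_X_sub_C]

/-- A family of all the eigenvalues of `X`, with multiplicity. -/
theorem exists_eigenvalue_family {n : ℕ} (X : Matrix (Fin n) (Fin n) ℂ) :
    ∃ a : Fin n → ℂ, X.charpoly.roots = Finset.univ.val.map a := by
  have hcard : X.charpoly.roots.card = n := by
    rw [(Polynomial.splits_iff_card_roots.mp (IsAlgClosed.splits X.charpoly)),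
      charpoly_natDegree_eq_dim, Fintype.card_fin]
  obtain ⟨l, hl⟩ := Quot.exists_rep X.charpoly.roots
  change (l : Multiset ℂ) = _ at hl
  have hlen : l.length = n := by rw [← Multiset.coe_card, hl, hcard]
  subst hlen
  exact ⟨l.get, by rw [← hl]; simp [Fin.univ_val_map]⟩

theorem succ_mul_newtonC {A : Type} [CommRing A] [Algebra ℂ A] (p : ℕ → A) (m : ℕ) :
    ((m : A) + 1) * newtonC p (m + 1) =
      ∑ k ∈ Finset.range (m + 1), (-1) ^ k * newtonC p (m - k) * p (k + 1) := by
  rw [newtonC, ← Finset.sum_range (fun k => (-1) ^ k * newtonC p (m - k) * p (k + 1))]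
  have : ((m : A) + 1) = algebraMap ℂ A ((m : ℂ) + 1) := by simp
  rw [this, ← Algebra.smul_def, smul_smul, mul_inv_cancel₀ (Nat.cast_add_one_ne_zero m), one_smul]

theorem newtonC_powTrace_eq_esymm {n : ℕ} (X : Matrix (Fin n) (Fin n) ℂ) (m : ℕ) :
    newtonC (powTrace X) m = X.charpoly.roots.esymm m := by
  obtain ⟨a, ha⟩ := exists_eigenvalue_family X
  have hp : ∀ k, powTrace X k = MvPolynomial.aeval a (MvPolynomial.psum (Fin n) ℂ k) := by
    intro k
    rw [powTrace, trace_pow_eq_sum_roots_charpoly, ha, Multiset.map_map]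
    simp only [MvPolynomial.psum, map_sum, map_pow, MvPolynomial.aeval_X]
    rfl
  rw [ha, ← MvPolynomial.aeval_esymm_eq_multiset_esymm (Fin n) ℂ]
  induction m using Nat.strong_induction_on with
  | _ m ih =>
    rcases m with _ | m
    · simp [newtonC]
    · have h1 := succ_mul_newtonC (powTrace X) m
      have h2 := congrArg (MvPolynomial.aeval a) (MvPolynomial.mul_esymm_eq_sum (Fin n) ℂ (m + 1))
      have hne : (m : ℂ) + 1 ≠ 0 := Nat.cast_add_one_ne_zero m
      apply mul_left_cancel₀ hne
      -- `newtonC` sums over the index of the power sum, `mul_esymm_eq_sum` over that of the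
      -- elementary symmetric function; reflection matches them.
      rw [h1, ← Finset.sum_range_reflect]
      simp only [map_mul, map_add, map_natCast, map_pow, map_neg, map_one, map_sum, Nat.cast_add,
        Nat.cast_one, ← hp] at h2
      rw [h2, Finset.sum_filter, Finset.Nat.sum_antidiagonal_eq_sum_range_succ_mk,
        Nat.succ_eq_add_one, Finset.sum_range_succ _ (m + 1), if_neg (by simp), add_zero,
        Finset.mul_sum]
      refine Finset.sum_congr rfl fun k hk => ?_
      have hk' : k < m + 1 := Finset.mem_range.mp hk
      rw [if_pos (by simpa using hk'), ih _ (by omega)]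
      have e1 : m - (m + 1 - 1 - k) = k := by omega
      have e2 : m + 1 - 1 - k + 1 = m + 1 - k := by omega
      have e3 : (-1 : ℂ) ^ (m + 1 - 1 - k) = (-1) ^ (m + 1 + 1) * (-1) ^ k := by
        have : m + 1 + 1 + k = (m + 1 - 1 - k) + 2 * (k + 1) := by omega
        rw [← pow_add, this, pow_add, pow_mul]
        simp
      simp only [e1, e2, e3]
      ring

theorem charpoly_coeff_eq_newtonC {n : ℕ} (X : Matrix (Fin n) (Fin n) ℂ) {k : ℕ} (hk : k ≤ n) :
    X.charpoly.coeff k = (-1) ^ (n - k) * newtonC (powTrace X) (n - k) := by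
  have hc := Polynomial.splits_iff_card_roots.mp (IsAlgClosed.splits X.charpoly)
  rw [Polynomial.coeff_eq_esymm_roots_of_card hc (by simpa using hk), newtonC_powTrace_eq_esymm,
    X.charpoly_monic.leadingCoeff, charpoly_natDegree_eq_dim, Fintype.card_fin, one_mul]

theorem newtonC_powTrace_card {n : ℕ} (X : Matrix (Fin n) (Fin n) ℂ) :
    newtonC (powTrace X) n = X.det := by
  have h := charpoly_coeff_eq_newtonC X (Nat.zero_le n)
  rw [det_eq_sign_charpoly_coeff, h, Fintype.card_fin, Nat.sub_zero, ← mul_assoc, ← mul_pow]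
  simp

/-- The recursion for `n C^n` has the terms of `P` up to sign, plus a last term `± p n`. -/
theorem newtonP_eq_add_newtonC {A : Type} [CommRing A] [Algebra ℂ A] {n : ℕ} (hn : n ≠ 0)
    (p : ℕ → A) :
    newtonP n p = p n + (-1) ^ n * (n : A) * (newtonC p n - 1) := by
  obtain ⟨m, rfl⟩ := Nat.exists_eq_succ_of_ne_zero hn
  have h := succ_mul_newtonC p m
  rw [Finset.sum_range_succ, Nat.sub_self] at h
  rw [newtonP, Finset.sum_Ico_eq_sum_range]
  have e : ∑ k ∈ Finset.range (m.succ - 1),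
      (-1 : A) ^ (m.succ + (1 + k) + 1) * newtonC p (m.succ - (1 + k)) * p (1 + k) =
      (-1) ^ (m + 1) * ∑ k ∈ Finset.range m, (-1) ^ k * newtonC p (m - k) * p (k + 1) := by
    rw [Finset.mul_sum]
    refine Finset.sum_congr rfl fun k _ => ?_
    rw [show m.succ - (1 + k) = m - k by omega, add_comm 1 k,
      show m.succ + (k + 1) + 1 = (m + 1 + k) + 2 by omega, pow_add, pow_add]
    ring
  have h0 : newtonC p 0 = 1 := by simp [newtonC]
  rw [e, eq_sub_of_add_eq h.symm, h0]
  have hsq : ((-1 : A) ^ m) * (-1) ^ m = 1 := by rw [← mul_pow]; simp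
  simp only [Nat.succ_eq_add_one, Nat.cast_add, Nat.cast_one, pow_succ]
  linear_combination (p (m + 1)) * hsq

theorem newtonP_powTrace {n : ℕ} (X : Matrix (Fin n) (Fin n) ℂ) :
    newtonP n (powTrace X) = (X ^ n).trace + (-1) ^ n * (n : ℂ) * (X.det - 1) := by
  rcases eq_or_ne n 0 with rfl | hn
  · simp [newtonP, Matrix.trace]
  · rw [newtonP_eq_add_newtonC hn, newtonC_powTrace_card, powTrace]

theorem map_newtonC {A B : Type} [CommRing A] [Algebra ℂ A] [CommRing B] [Algebra ℂ B]
    (φ : A →ₐ[ℂ] B) (p : ℕ → A) (m : ℕ) : φ (newtonC p m) = newtonC (fun k => φ (p k)) m := by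
  induction m using Nat.strong_induction_on with
  | _ m ih =>
    rcases m with _ | m
    · simp [newtonC]
    · rw [newtonC, newtonC, map_smul, map_sum]
      congr 1
      refine Finset.sum_congr rfl fun k _ => ?_
      rw [map_mul, map_mul, ih _ (by omega), map_pow, map_neg, map_one]

theorem map_newtonP {A B : Type} [CommRing A] [Algebra ℂ A] [CommRing B] [Algebra ℂ B]
    (φ : A →ₐ[ℂ] B) (n : ℕ) (p : ℕ → A) : φ (newtonP n p) = newtonP n (fun k => φ (p k)) := by
  simp [newtonP, map_newtonC]

theorem newtonC_congr {A : Type} [CommRing A] [Algebra ℂ A] {p q : ℕ → A} {m : ℕ}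
    (h : ∀ k, 1 ≤ k → k ≤ m → p k = q k) : newtonC p m = newtonC q m := by
  induction m using Nat.strong_induction_on with
  | _ m ih =>
    rcases m with _ | m
    · simp [newtonC]
    · rw [newtonC, newtonC]
      congr 1
      refine Finset.sum_congr rfl fun k _ => ?_
      rw [ih _ (by omega) fun j h1 h2 => h j h1 (by omega), h _ (by omega) (by omega)]

theorem newtonP_congr {A : Type} [CommRing A] [Algebra ℂ A] {p q : ℕ → A} {n : ℕ}
    (h : ∀ k, 1 ≤ k → k < n → p k = q k) : newtonP n p = newtonP n q := by
  rw [newtonP, newtonP]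
  congr 1
  refine Finset.sum_congr rfl fun k hk => ?_
  have := Finset.mem_Ico.mp hk
  rw [newtonC_congr fun j h1 h2 => h j h1 (by omega), h k (by omega) (by omega)]

theorem newtonP_polynomial_in_traces (n : ℕ) :
    ∃ Q : MvPolynomial (Fin (n - 1)) ℂ, ∀ X : Matrix (Fin n) (Fin n) ℂ,
      newtonP n (powTrace X) =
        MvPolynomial.eval (fun i : Fin (n - 1) => (X ^ ((i : ℕ) + 1)).trace) Q := by
  -- `newtonP n` reads only `p 1, …, p (n - 1)`, so the default value `0` is harmless.
  refine ⟨newtonP n fun k => if h : k - 1 < n - 1 then MvPolynomial.X ⟨k - 1, h⟩ else 0,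
    fun X => ?_⟩
  rw [← MvPolynomial.coe_aeval_eq_eval, RingHom.coe_coe, map_newtonP]
  refine newtonP_congr fun k h1 h2 => ?_
  rw [dif_pos (by omega), MvPolynomial.aeval_X, powTrace, Nat.sub_add_cancel h1]

theorem newtonC_mem_charpoly_coeffs {n m : ℕ} (hm : m ≤ n) :
    (fun X : Matrix (Fin n) (Fin n) ℂ => newtonC (powTrace X) m) ∈
      coordinateRing fun (i : Fin n) (X : Matrix (Fin n) (Fin n) ℂ) => X.charpoly.coeff i := by
  -- `m = 0` would need the leading coefficient, which is not among the `n` coordinates.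
  rcases Nat.eq_zero_or_pos m with rfl | hpos
  · simp only [newtonC]
    exact one_mem _
  · refine ⟨(-1) ^ m * MvPolynomial.X ⟨n - m, by omega⟩, ?_⟩
    funext X
    have h := charpoly_coeff_eq_newtonC X (Nat.sub_le n m)
    rw [Nat.sub_sub_self hm] at h
    simp [h, ← mul_assoc, ← mul_pow]

/-- Newton's recursion can be solved for its last power sum, whose coefficient is a sign. -/
theorem powTrace_mem_charpoly_coeffs {n : ℕ} (k : ℕ) (hk : k ≤ n) :
    (fun X : Matrix (Fin n) (Fin n) ℂ => powTrace X k) ∈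
      coordinateRing fun (i : Fin n) (X : Matrix (Fin n) (Fin n) ℂ) => X.charpoly.coeff i := by
  induction k using Nat.strong_induction_on with
  | _ k ih =>
    rcases k with _ | k
    · simp only [powTrace, pow_zero, trace_one, Fintype.card_fin]
      exact natCast_mem _ n
    · have e : (fun X : Matrix (Fin n) (Fin n) ℂ => powTrace X (k + 1)) =
          (-1) ^ k * (((k : Matrix (Fin n) (Fin n) ℂ → ℂ) + 1) *
            (fun X => newtonC (powTrace X) (k + 1)) -
            ∑ j ∈ Finset.range k, (-1) ^ j * (fun X => newtonC (powTrace X) (k - j)) *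
              (fun X => powTrace X (j + 1))) := by
        funext X
        have h := succ_mul_newtonC (powTrace X) k
        rw [Finset.sum_range_succ, Nat.sub_self] at h
        have h0 : newtonC (powTrace X) 0 = 1 := by simp [newtonC]
        have hsq : ((-1 : ℂ) ^ k) * (-1) ^ k = 1 := by rw [← mul_pow]; simp
        simp only [Pi.mul_apply, Pi.pow_apply, Pi.neg_apply, Pi.one_apply, Pi.sub_apply,
          Pi.add_apply, Pi.natCast_apply, Finset.sum_apply, h, h0]
        linear_combination -(powTrace X (k + 1)) * hsq
      rw [e]
      refine mul_mem (pow_mem (neg_mem (one_mem _)) _) (sub_mem (mul_mem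
        (add_mem (natCast_mem _ _) (one_mem _)) (newtonC_mem_charpoly_coeffs hk))
        (sum_mem fun j hj => ?_))
      have := Finset.mem_range.mp hj
      exact mul_mem (mul_mem (pow_mem (neg_mem (one_mem _)) _)
        (newtonC_mem_charpoly_coeffs (by omega))) (ih _ (by omega) (by omega))

theorem newtonP_polynomial_in_charpoly_coeffs (n : ℕ) :
    ∃ Q : MvPolynomial (Fin n) ℂ, ∀ X : Matrix (Fin n) (Fin n) ℂ,
      newtonP n (powTrace X) =
        MvPolynomial.eval (fun i : Fin n => X.charpoly.coeff (i : ℕ)) Q := by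
  have h : (fun X : Matrix (Fin n) (Fin n) ℂ => newtonP n (powTrace X)) ∈
      coordinateRing fun (i : Fin n) (X : Matrix (Fin n) (Fin n) ℂ) => X.charpoly.coeff i := by
    have e : (fun X : Matrix (Fin n) (Fin n) ℂ => newtonP n (powTrace X)) =
        (-1) ^ (n + 1) * (n : Matrix (Fin n) (Fin n) ℂ → ℂ) +
          ∑ k ∈ Finset.Ico 1 n, (-1) ^ (n + k + 1) * (fun X => newtonC (powTrace X) (n - k)) *
            (fun X => powTrace X k) := by
      funext X
      simp [newtonP]
    rw [e]
    refine add_mem (mul_mem (pow_mem (neg_mem (one_mem _)) _) (natCast_mem _ _))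
      (sum_mem fun k hk => ?_)
    have := Finset.mem_Ico.mp hk
    exact mul_mem (mul_mem (pow_mem (neg_mem (one_mem _)) _)
      (newtonC_mem_charpoly_coeffs (Nat.sub_le _ _))) (powTrace_mem_charpoly_coeffs _ (by omega))
  obtain ⟨Q, hQ⟩ := h
  refine ⟨Q, fun X => ?_⟩
  have hX := congrFun hQ X
  have hev : ∀ Q : MvPolynomial (Fin n) ℂ, MvPolynomial.aeval
      (fun (i : Fin n) (X : Matrix (Fin n) (Fin n) ℂ) => X.charpoly.coeff i) Q X =
      MvPolynomial.eval (fun i : Fin n => X.charpoly.coeff (i : ℕ)) Q := by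
    intro Q
    induction Q using MvPolynomial.induction_on <;> simp_all
  rw [← hev]
  exact hX.symm

end Newton

/-! ### Scalings, multihomogeneous components and balanced functions. -/

section Scaling

/-- Rescaling of each member of a tuple of matrices. -/
def scaleTuple {n r : ℕ} (t : Fin r → ℂ) (X : GlTuple n r) : GlTuple n r := fun k => t k • X k

/-- The tuple of matrices underlying a tuple in `SL(n, ℂ)^r`. -/
def toGlTuple {n r : ℕ} (x : SLTuple n r) : GlTuple n r :=
  fun k => (x k : Matrix (Fin n) (Fin n) ℂ)

theorem scaleTuple_scaleTuple {n r : ℕ} (s t : Fin r → ℂ) (X : GlTuple n r) :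
    scaleTuple s (scaleTuple t X) = scaleTuple (fun k => s k * t k) X := by
  funext k
  simp [scaleTuple, smul_smul]

theorem scaleTuple_one {n r : ℕ} (X : GlTuple n r) : scaleTuple (fun _ => 1) X = X := by
  funext k
  simp [scaleTuple]

theorem glConj_scaleTuple {n r : ℕ} (g : GL (Fin n) ℂ) (t : Fin r → ℂ) (X : GlTuple n r) :
    glConj n r g (scaleTuple t X) = scaleTuple t (glConj n r g X) := by
  funext k
  simp [scaleTuple, glConj]

theorem aeval_apply_eq_eval {σ Y : Type} (c : σ → Y → ℂ) (p : MvPolynomial σ ℂ) (y : Y) :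
    (MvPolynomial.aeval c p : Y → ℂ) y = MvPolynomial.eval (fun s => c s y) p := by
  induction p using MvPolynomial.induction_on <;> simp_all

theorem sum_prod_pow_mul_injective {r : ℕ} {S : Finset (Fin r →₀ ℕ)} {a b : (Fin r →₀ ℕ) → ℂ}
    (h : ∀ t : Fin r → ℂ, ∑ d ∈ S, (∏ k, t k ^ d k) * a d = ∑ d ∈ S, (∏ k, t k ^ d k) * b d) :
    ∀ d ∈ S, a d = b d := by
  have hp : ∑ d ∈ S, MvPolynomial.monomial d (a d) = ∑ d ∈ S, MvPolynomial.monomial d (b d) := by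
    refine MvPolynomial.funext fun t => ?_
    simpa [MvPolynomial.eval_monomial, Finsupp.prod_fintype, mul_comm] using h t
  intro d hd
  have := congrArg (MvPolynomial.coeff d) hp
  simpa [MvPolynomial.coeff_sum, MvPolynomial.coeff_monomial, hd] using this

/-- A polynomial function on `gl(n, ℂ)^r` is a sum of multihomogeneous polynomial functions. -/
theorem exists_scaling_expansion {n r : ℕ} {f : GlTuple n r → ℂ}
    (hf : f ∈ coordinateRing (glCoord n r)) :
    ∃ (S : Finset (Fin r →₀ ℕ)) (c : (Fin r →₀ ℕ) → GlTuple n r → ℂ),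
      (∀ d, c d ∈ coordinateRing (glCoord n r)) ∧
      ∀ t X, f (scaleTuple t X) = ∑ d ∈ S, (∏ k, t k ^ d k) * c d X := by
  obtain ⟨p, rfl⟩ := hf
  -- Substituting `t_k x_{ij}^k` for `x_{ij}^k` and collecting powers of `t` yields the components
  -- as coefficients.
  let Q : MvPolynomial (Fin r) (MvPolynomial (Fin r × Fin n × Fin n) ℂ) :=
    MvPolynomial.aeval (fun s => MvPolynomial.X s.1 * MvPolynomial.C (MvPolynomial.X s)) p
  refine ⟨Q.support, fun d => MvPolynomial.aeval (glCoord n r) (Q.coeff d),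
    fun d => ⟨_, rfl⟩, fun t X => ?_⟩
  have h : MvPolynomial.eval (fun s => glCoord n r s (scaleTuple t X)) p =
      MvPolynomial.eval₂ (MvPolynomial.eval fun s => glCoord n r s X) t Q := by
    simp only [Q]
    clear Q
    induction p using MvPolynomial.induction_on with
    | C a => simp [MvPolynomial.algebraMap_eq, IsScalarTower.algebraMap_apply ℂ
        (MvPolynomial (Fin r × Fin n × Fin n) ℂ)
        (MvPolynomial (Fin r) (MvPolynomial (Fin r × Fin n × Fin n) ℂ))]
    | add p q hp hq => simp [hp, hq]
    | mul_X p s hp =>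
      have hs : glCoord n r s (scaleTuple t X) = t s.1 * glCoord n r s X := rfl
      simp [hp, hs]
  change (MvPolynomial.aeval (glCoord n r) p : GlTuple n r → ℂ) _ = _
  rw [aeval_apply_eq_eval, h, MvPolynomial.eval₂_eq']
  refine Finset.sum_congr rfl fun d _ => ?_
  rw [mul_comm, ← aeval_apply_eq_eval]

/-- Expand `f` at the tuple scaled by `s k * t k` in two ways and compare coefficients in `s`. -/
theorem expansion_apply_scaleTuple {n r : ℕ} {f : GlTuple n r → ℂ} {S : Finset (Fin r →₀ ℕ)}
    {c : (Fin r →₀ ℕ) → GlTuple n r → ℂ}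
    (h : ∀ t X, f (scaleTuple t X) = ∑ d ∈ S, (∏ k, t k ^ d k) * c d X)
    (t : Fin r → ℂ) (X : GlTuple n r) :
    ∀ d ∈ S, c d (scaleTuple t X) = (∏ k, t k ^ d k) * c d X := by
  refine sum_prod_pow_mul_injective fun s => ?_
  rw [← h, scaleTuple_scaleTuple, h]
  refine Finset.sum_congr rfl fun d _ => ?_
  simp only [mul_pow, Finset.prod_mul_distrib]
  ring

theorem expansion_apply_glConj {n r : ℕ} {f : GlTuple n r → ℂ} {S : Finset (Fin r →₀ ℕ)}
    {c : (Fin r →₀ ℕ) → GlTuple n r → ℂ}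
    (h : ∀ t X, f (scaleTuple t X) = ∑ d ∈ S, (∏ k, t k ^ d k) * c d X)
    (hf : f ∈ invariantFunctions (glConj n r)) (g : GL (Fin n) ℂ) (X : GlTuple n r) :
    ∀ d ∈ S, c d (glConj n r g X) = c d X := by
  refine sum_prod_pow_mul_injective fun s => ?_
  rw [← h, ← h, ← glConj_scaleTuple]
  exact hf g _

/-- A function `F` is balanced at level `M` if, on each orbit of the scalings, `F (t • X)` is
`∏ k, (t k) ^ (n * M)` times a polynomial in `t` of degree less than `n` in each variable. -/
def IsBalanced {n r : ℕ} (M : ℕ) (F : GlTuple n r → ℂ) : Prop :=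
  ∀ X, ∃ q : MvPolynomial (Fin r) ℂ, (∀ k, q.degreeOf k < n) ∧
    ∀ t, F (scaleTuple t X) = (∏ k, t k ^ (n * M)) * MvPolynomial.eval t q

theorem IsBalanced.sub {n r M : ℕ} {F G : GlTuple n r → ℂ} (hF : IsBalanced M F)
    (hG : IsBalanced M G) : IsBalanced M fun X => F X - G X := by
  intro X
  obtain ⟨p, hp, hp'⟩ := hF X
  obtain ⟨q, hq, hq'⟩ := hG X
  refine ⟨p - q, fun k => ?_, fun t => ?_⟩
  · exact (MvPolynomial.degreeOf_sub_le k p q).trans_lt (max_lt (hp k) (hq k))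
  · simp only [hp', hq', map_sub, mul_sub]

theorem IsBalanced.comp_glConj {n r M : ℕ} {F : GlTuple n r → ℂ} (hF : IsBalanced M F)
    (g : GL (Fin n) ℂ) : IsBalanced M fun X => F (glConj n r g X) := by
  intro X
  obtain ⟨p, hp, hp'⟩ := hF (glConj n r g X)
  exact ⟨p, hp, fun t => by simp only [← hp', glConj_scaleTuple]⟩

/-- Every polynomial function becomes balanced after its multihomogeneous components are
multiplied by suitable products of powers of determinants. -/
theorem exists_balanced {n r : ℕ} (hn : n ≠ 0) {f : GlTuple n r → ℂ}
    (hf : f ∈ coordinateRing (glCoord n r)) :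
    ∃ (M : ℕ) (S : Finset (Fin r →₀ ℕ)) (c : (Fin r →₀ ℕ) → GlTuple n r → ℂ)
      (e : (Fin r →₀ ℕ) → Fin r → ℕ),
      (∀ d, c d ∈ coordinateRing (glCoord n r)) ∧
      (f ∈ invariantFunctions (glConj n r) →
        ∀ d ∈ S, c d ∈ invariantFunctions (glConj n r)) ∧
      (∀ X, f X = ∑ d ∈ S, c d X) ∧
      IsBalanced M fun X : GlTuple n r => ∑ d ∈ S, c d X * ∏ k, (X k).det ^ e d k := by
  obtain ⟨S, c, hc, h⟩ := exists_scaling_expansion hf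
  -- Any common bound for the `d k / n` serves; it keeps the subtraction `M - d k / n` from
  -- truncating.
  let M := S.sup fun d => ∑ k, d k / n
  have hM : ∀ d ∈ S, ∀ k, d k / n ≤ M := fun d hd k =>
    (Finset.single_le_sum (f := fun k => d k / n) (fun _ _ => Nat.zero_le _)
      (Finset.mem_univ k)).trans (Finset.le_sup (f := fun d : Fin r →₀ ℕ => ∑ k, d k / n) hd)
  refine ⟨M, S, c, fun d k => M - d k / n, hc,
    fun hinv d hd g X => expansion_apply_glConj h hinv g X d hd, fun X => ?_, fun X => ?_⟩
  · simpa [scaleTuple_one] using h (fun _ => 1) X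
  · let q : MvPolynomial (Fin r) ℂ := ∑ d ∈ S,
      MvPolynomial.C (c d X * ∏ k, (X k).det ^ (M - d k / n)) *
        ∏ k, MvPolynomial.X k ^ (d k % n)
    refine ⟨q, fun k => ?_, fun t => ?_⟩
    · refine (MvPolynomial.degreeOf_sum_le k S _).trans_lt ?_
      rw [Finset.sup_lt_iff (Nat.pos_of_ne_zero hn)]
      intro d _
      refine (MvPolynomial.degreeOf_C_mul_le _ k _).trans_lt ?_
      refine (MvPolynomial.degreeOf_prod_le k _ _).trans_lt ?_
      refine (Finset.sum_le_sum fun j _ =>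
        MvPolynomial.degreeOf_pow_le k (MvPolynomial.X j) _).trans_lt ?_
      simp only [MvPolynomial.degreeOf_X, mul_ite, mul_one, mul_zero]
      rw [Finset.sum_ite_eq Finset.univ k, if_pos (Finset.mem_univ k)]
      exact Nat.mod_lt _ (Nat.pos_of_ne_zero hn)
    · simp only [q, map_sum, map_mul, map_prod, map_pow, MvPolynomial.eval_C, MvPolynomial.eval_X,
        Finset.mul_sum]
      refine Finset.sum_congr rfl fun d hd => ?_
      rw [expansion_apply_scaleTuple h t X d hd]
      -- The exponents of `t k` agree: `d k + n * (M - d k / n) = n * M + d k % n`.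
      have hk : ∀ k, t k ^ d k * (scaleTuple t X k).det ^ (M - d k / n) =
          t k ^ (n * M) * (t k ^ (d k % n) * (X k).det ^ (M - d k / n)) := by
        intro k
        rw [scaleTuple, det_smul, Fintype.card_fin, mul_pow, ← pow_mul, ← mul_assoc, ← mul_assoc,
          ← pow_add, ← pow_add]
        congr 2
        have h1 := Nat.div_add_mod (d k) n
        obtain ⟨b, hb⟩ := Nat.exists_eq_add_of_le (hM d hd k)
        rw [hb, Nat.add_sub_cancel_left, mul_add]
        omega
      have := Finset.prod_congr (rfl : (Finset.univ : Finset (Fin r)) = _) fun k _ => hk k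
      simp only [Finset.prod_mul_distrib] at this
      linear_combination c d X * this

theorem det_mem (n r : ℕ) (k : Fin r) :
    (fun X : GlTuple n r => (X k).det) ∈ GlQuotientRing n r := by
  refine ⟨?_, fun g X => ?_⟩
  · have e : (fun X : GlTuple n r => (X k).det) = ∑ σ : Equiv.Perm (Fin n),
        (algebraMap ℂ (GlTuple n r → ℂ) ((Equiv.Perm.sign σ : ℤ) : ℂ)) *
          ∏ i, glCoord n r (k, σ i, i) := by
      funext X
      simp [det_apply', glCoord]
    rw [e]
    exact sum_mem fun σ _ => mul_mem (Subalgebra.algebraMap_mem _ _)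
      (prod_mem fun i _ => ⟨MvPolynomial.X (k, σ i, i), by simp⟩)
  · simp only [glConj]
    rw [det_units_conj]

/-- The product of `F` with all the determinants vanishes everywhere, and the polynomial ring is a
domain. -/
theorem eq_zero_of_eq_zero_on_invertible {n r : ℕ} {F : GlTuple n r → ℂ}
    (hF : F ∈ coordinateRing (glCoord n r))
    (h : ∀ X : GlTuple n r, (∀ k, (X k).det ≠ 0) → F X = 0) (X : GlTuple n r) : F X = 0 := by
  obtain ⟨q, hq⟩ : (∏ k, fun X : GlTuple n r => (X k).det) ∈ coordinateRing (glCoord n r) :=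
    prod_mem fun k _ => (det_mem n r k).1
  obtain ⟨p, rfl⟩ := hF
  have hq' : ∀ Y : GlTuple n r, MvPolynomial.eval (fun s => glCoord n r s Y) q =
      ∏ k, (Y k).det := by
    intro Y
    rw [← aeval_apply_eq_eval]
    exact (congrFun hq Y).trans (by simp)
  have hpq : p * q = 0 := by
    refine MvPolynomial.funext fun y => ?_
    let Y : GlTuple n r := fun k => Matrix.of fun i j => y (k, i, j)
    have hy : (fun s => glCoord n r s Y) = y := rfl
    rw [map_mul, map_zero, ← hy, hq']
    by_cases hY : ∀ k, (Y k).det ≠ 0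
    · rw [← aeval_apply_eq_eval]
      exact mul_eq_zero_of_left (h Y hY) _
    · push Not at hY
      obtain ⟨k, hk⟩ := hY
      rw [Finset.prod_eq_zero (Finset.mem_univ k) hk, mul_zero]
  have hq0 : q ≠ 0 := by
    rintro rfl
    have := hq' fun _ => 1
    simp at this
  rw [(mul_eq_zero.mp hpq).resolve_right hq0]
  simp

theorem exists_smul_specialLinear {n : ℕ} (hn : n ≠ 0) (A : Matrix (Fin n) (Fin n) ℂ)
    (hA : A.det ≠ 0) :
    ∃ (t : ℂ) (Y : SpecialLinearGroup (Fin n) ℂ), t ≠ 0 ∧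
      A = t • (Y : Matrix (Fin n) (Fin n) ℂ) := by
  obtain ⟨t, ht⟩ := IsAlgClosed.exists_pow_nat_eq A.det (Nat.pos_of_ne_zero hn)
  have ht0 : t ≠ 0 := by
    rintro rfl
    exact hA (by rw [← ht, zero_pow hn])
  refine ⟨t, ⟨t⁻¹ • A, ?_⟩, ht0, ?_⟩
  · rw [det_smul, Fintype.card_fin, ← ht, ← mul_pow, inv_mul_cancel₀ ht0, one_pow]
  · rw [smul_smul, mul_inv_cancel₀ ht0, one_smul]

/-- A balanced polynomial function is determined by its restriction to `SL(n, ℂ)^r`. -/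
theorem IsBalanced.eq_zero {n r M : ℕ} (hn : n ≠ 0) {F : GlTuple n r → ℂ} (hb : IsBalanced M F)
    (hF : F ∈ coordinateRing (glCoord n r)) (h : ∀ x : SLTuple n r, F (toGlTuple x) = 0)
    (X : GlTuple n r) : F X = 0 := by
  refine eq_zero_of_eq_zero_on_invertible hF (fun X hX => ?_) X
  choose t Y _ htY using fun k => exists_smul_specialLinear hn (X k) (hX k)
  obtain ⟨q, hq, hq'⟩ := hb (toGlTuple Y)
  have hX' : X = scaleTuple t (toGlTuple Y) := funext htY
  have hq0 : q = 0 := by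
    -- On the grid of `n`-th roots of unity the scaled tuple stays in `SL^r` and the prefactor is
    -- `1`, so `q` vanishes there; its degrees are too small for that unless `q = 0`.
    refine MvPolynomial.eq_zero_of_eval_zero_at_prod_finset q
      (fun _ => Polynomial.nthRootsFinset n (1 : ℂ)) (fun k => ?_) fun z hz => ?_
    · rw [(Complex.isPrimitiveRoot_exp n hn).card_nthRootsFinset]
      exact hq k
    · have hz' : ∀ k, z k ^ n = 1 := fun k =>
        (Polynomial.mem_nthRootsFinset (Nat.pos_of_ne_zero hn) (1 : ℂ)).mp (hz k)
      have h1 := hq' z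
      let Z : SLTuple n r := fun k => ⟨z k • (Y k : Matrix (Fin n) (Fin n) ℂ), by
        rw [det_smul, Fintype.card_fin, hz' k, one_mul, (Y k).det_coe]⟩
      have h2 : scaleTuple z (toGlTuple Y) = toGlTuple Z := rfl
      rw [h2, h Z] at h1
      simpa [pow_mul, hz'] using h1.symm
  rw [hX', hq', hq0, map_zero, mul_zero]

end Scaling

/-! ### Kernel and image of the restriction map. -/

section Restriction

theorem toGlTuple_slConj {n r : ℕ} (g : SpecialLinearGroup (Fin n) ℂ) (x : SLTuple n r) :
    toGlTuple (slConj n r g x) = glConj n r (SpecialLinearGroup.toGL g) (toGlTuple x) := by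
  funext k
  simp only [toGlTuple, slConj, glConj, ← map_inv]
  rfl

/-- Restriction of invariant polynomial functions from `gl(n, ℂ)^r` to `SL(n, ℂ)^r`. -/
noncomputable def restriction (n r : ℕ) : GlQuotientRing n r →ₐ[ℂ] SLQuotientRing n r :=
  ((AlgHom.pi fun x : SLTuple n r =>
    Pi.evalAlgHom ℂ (fun _ : GlTuple n r => ℂ) (toGlTuple x)).comp
      (GlQuotientRing n r).val).codRestrict (SLQuotientRing n r) fun f => by
    refine ⟨?_, fun g x => ?_⟩
    · obtain ⟨p, hp⟩ := f.2.1
      refine ⟨p, ?_⟩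
      funext x
      change (MvPolynomial.aeval (slCoord n r) p : SLTuple n r → ℂ) x = f.1 (toGlTuple x)
      rw [aeval_apply_eq_eval, ← hp]
      exact (aeval_apply_eq_eval (glCoord n r) p (toGlTuple x)).symm
    · change f.1 (toGlTuple (slConj n r g x)) = f.1 (toGlTuple x)
      rw [toGlTuple_slConj]
      exact f.2.2 _ _

theorem restriction_eq_zero_iff {n r : ℕ} (f : GlQuotientRing n r) :
    restriction n r f = 0 ↔ ∀ x : SLTuple n r, f.1 (toGlTuple x) = 0 := by
  rw [← Subtype.coe_inj, funext_iff]
  rfl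

/-- `det(X_k)` as an element of `ℂ[gl(n, ℂ)^r // GL(n, ℂ)]`. -/
noncomputable def detInvariant (n r : ℕ) (k : Fin r) : GlQuotientRing n r :=
  ⟨fun X => (X k).det, det_mem n r k⟩

theorem tracePow_sub_newtonP (n r : ℕ) (k : Fin r) :
    tracePow n r k n - newtonP n (tracePow n r k) =
      (-((-1) ^ n * (n : ℂ))) • (detInvariant n r k - 1) := by
  refine Subtype.ext (funext fun X => ?_)
  have h := map_newtonP ((Pi.evalAlgHom ℂ (fun _ : GlTuple n r => ℂ) X).comp
    (GlQuotientRing n r).val) n (tracePow n r k)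
  change (newtonP n (tracePow n r k)).1 X = newtonP n (powTrace (X k)) at h
  change ((X k) ^ n).trace - (newtonP n (tracePow n r k)).1 X =
    (-((-1) ^ n * (n : ℂ))) * ((X k).det - 1)
  rw [h, newtonP_powTrace]
  ring

theorem unimodularIdeal_le_ker (n r : ℕ) :
    unimodularIdeal n r ≤ RingHom.ker (restriction n r) := by
  rw [unimodularIdeal, Ideal.span_le]
  rintro _ ⟨k, rfl⟩
  change restriction n r (tracePow n r k n - newtonP n (tracePow n r k)) = 0
  rw [tracePow_sub_newtonP, restriction_eq_zero_iff]
  intro x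
  change (-((-1) ^ n * (n : ℂ))) * ((x k : Matrix (Fin n) (Fin n) ℂ).det - 1) = 0
  rw [(x k).det_coe, sub_self, mul_zero]

/-- The generator is `det X_k - 1` times `±n`, which is invertible in `ℂ`. -/
theorem mk_detInvariant {n : ℕ} (hn : n ≠ 0) (r : ℕ) (k : Fin r) :
    Ideal.Quotient.mk (unimodularIdeal n r) (detInvariant n r k) = 1 := by
  rw [← map_one (Ideal.Quotient.mk (unimodularIdeal n r)), Ideal.Quotient.mk_eq_mk_iff_sub_mem]
  have hc : -((-1) ^ n * (n : ℂ)) ≠ 0 :=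
    neg_ne_zero.mpr (mul_ne_zero (pow_ne_zero _ (neg_ne_zero.mpr one_ne_zero))
      (Nat.cast_ne_zero.mpr hn))
  have h : detInvariant n r k - 1 = (-((-1) ^ n * (n : ℂ)))⁻¹ •
      (tracePow n r k n - newtonP n (tracePow n r k)) := by
    rw [tracePow_sub_newtonP, smul_smul, inv_mul_cancel₀ hc, one_smul]
  rw [h, Algebra.smul_def]
  exact Ideal.mul_mem_left _ _ (Ideal.subset_span ⟨k, rfl⟩)

theorem map_sum_eq_map_sum_mul_prod_pow {A B ι κ : Type*} [CommRing A] [CommRing B] [Fintype ι]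
    [Fintype κ] (φ : A →+* B) {u : κ → A} (hu : ∀ k, φ (u k) = 1) (c : ι → A) (e : ι → κ → ℕ) :
    φ (∑ d, c d) = φ (∑ d, c d * ∏ k, u k ^ e d k) := by
  simp [hu]

theorem ker_restriction (n r : ℕ) : RingHom.ker (restriction n r) = unimodularIdeal n r := by
  refine le_antisymm (fun f hf => ?_) (unimodularIdeal_le_ker n r)
  have hf0 := (restriction_eq_zero_iff f).mp hf
  rcases eq_or_ne n 0 with rfl | hn
  · have : f = 0 := by
      refine Subtype.ext (funext fun X => ?_)
      -- For `n = 0` there is only one tuple, and it comes from `SL^r`.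
      rw [Subsingleton.elim X (toGlTuple fun _ => 1)]
      exact hf0 _
    rw [this]
    exact zero_mem _
  obtain ⟨M, S, c, e, hc, hinv, hsum, hbal⟩ := exists_balanced hn f.2.1
  let c' : S → GlQuotientRing n r := fun d => ⟨c d, hc d, hinv f.2.2 d d.2⟩
  let F : GlQuotientRing n r := ∑ d, c' d * ∏ k, detInvariant n r k ^ e d k
  have hfsum : f = ∑ d, c' d := by
    refine Subtype.ext (funext fun X => ?_)
    rw [hsum X, ← Finset.sum_coe_sort S fun d => c d X, AddSubmonoidClass.coe_finsetSum,
      Finset.sum_apply]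
  have hFapply : ∀ X, F.1 X = ∑ d ∈ S, c d X * ∏ k, (X k).det ^ e d k := by
    intro X
    rw [← Finset.sum_coe_sort S fun d => c d X * ∏ k, (X k).det ^ e d k]
    simp [F, c', detInvariant]
  have hmk : Ideal.Quotient.mk (unimodularIdeal n r) f =
      Ideal.Quotient.mk (unimodularIdeal n r) F := by
    rw [hfsum]
    exact map_sum_eq_map_sum_mul_prod_pow (A := GlQuotientRing n r)
      (B := GlQuotientRing n r ⧸ unimodularIdeal n r) (u := detInvariant n r)
      (Ideal.Quotient.mk (unimodularIdeal n r)) (mk_detInvariant hn r) c' fun d => e d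
  have hF0 : F = 0 := by
    refine Subtype.ext (funext fun X => ?_)
    have hFbal : IsBalanced M F.1 := by
      rw [show F.1 = _ from funext hFapply]
      exact hbal
    refine hFbal.eq_zero hn F.2.1 (fun x => ?_) X
    rw [hFapply, ← hf0 x, hsum]
    refine Finset.sum_congr rfl fun d _ => ?_
    simp [toGlTuple]
  rw [← Ideal.Quotient.eq_zero_iff_mem, hmk, hF0, map_zero]

theorem glConj_eq_of_eq_smul {n r : ℕ} {g h : GL (Fin n) ℂ} {t : ℂ} (ht : t ≠ 0)
    (hg : (g : Matrix (Fin n) (Fin n) ℂ) = t • (h : Matrix (Fin n) (Fin n) ℂ))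
    (X : GlTuple n r) : glConj n r g X = glConj n r h X := by
  have hinv : ((g⁻¹ : GL (Fin n) ℂ) : Matrix (Fin n) (Fin n) ℂ) =
      t⁻¹ • ((h⁻¹ : GL (Fin n) ℂ) : Matrix (Fin n) (Fin n) ℂ) := by
    refine Units.inv_eq_of_mul_eq_one_right ?_
    rw [hg, smul_mul_smul_comm, mul_inv_cancel₀ ht, one_smul, Units.mul_inv]
  funext k
  simp only [glConj, hg, hinv, smul_mul_assoc, mul_smul_comm, smul_smul,
    inv_mul_cancel₀ ht, one_smul]

theorem comp_glConj_mem_coordinateRing {n r : ℕ} {F : GlTuple n r → ℂ}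
    (hF : F ∈ coordinateRing (glCoord n r)) (g : GL (Fin n) ℂ) :
    (fun X => F (glConj n r g X)) ∈ coordinateRing (glCoord n r) := by
  obtain ⟨p, rfl⟩ := hF
  have hcoord : ∀ s, (fun X => glCoord n r s (glConj n r g X)) ∈ coordinateRing (glCoord n r) := by
    intro s
    have e : (fun X => glCoord n r s (glConj n r g X)) = ∑ j, (∑ i,
        algebraMap ℂ (GlTuple n r → ℂ) ((g : Matrix (Fin n) (Fin n) ℂ) s.2.1 i) *
          glCoord n r (s.1, i, j)) * algebraMap ℂ (GlTuple n r → ℂ)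
            (((g⁻¹ : GL (Fin n) ℂ) : Matrix (Fin n) (Fin n) ℂ) j s.2.2) := by
      funext X
      simp only [glCoord, glConj, Matrix.mul_apply, Finset.sum_apply, Pi.mul_apply,
        Pi.algebraMap_apply, Algebra.algebraMap_self, RingHom.id_apply]
    rw [e]
    exact sum_mem fun j _ => mul_mem (sum_mem fun i _ => mul_mem (Subalgebra.algebraMap_mem _ _)
      ⟨MvPolynomial.X (s.1, i, j), by simp⟩) (Subalgebra.algebraMap_mem _ _)
  have e : (fun X => (MvPolynomial.aeval (glCoord n r) p : GlTuple n r → ℂ) (glConj n r g X)) =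
      MvPolynomial.aeval (fun s X => glCoord n r s (glConj n r g X)) p := by
    funext X
    rw [aeval_apply_eq_eval, aeval_apply_eq_eval]
  change (fun X => (MvPolynomial.aeval (glCoord n r) p : GlTuple n r → ℂ) (glConj n r g X)) ∈ _
  rw [e]
  have hrange : (MvPolynomial.aeval fun s X => glCoord n r s (glConj n r g X) :
      MvPolynomial (Fin r × Fin n × Fin n) ℂ →ₐ[ℂ] (GlTuple n r → ℂ)).range ≤
      coordinateRing (glCoord n r) := by
    rw [← Algebra.adjoin_range_eq_range_aeval, Algebra.adjoin_le_iff]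
    rintro _ ⟨s, rfl⟩
    exact hcoord s
  exact hrange ⟨p, rfl⟩

theorem restriction_surjective (n r : ℕ) : Function.Surjective (restriction n r) := by
  intro f
  obtain ⟨p, hp⟩ := f.2.1
  have hpx : ∀ x, MvPolynomial.aeval (glCoord n r) p (toGlTuple x) = f.1 x := by
    intro x
    rw [← hp, aeval_apply_eq_eval]
    exact (aeval_apply_eq_eval (slCoord n r) p x).symm
  rcases eq_or_ne n 0 with rfl | hn
  · refine ⟨⟨MvPolynomial.aeval (glCoord 0 r) p, ⟨p, rfl⟩, fun g X => ?_⟩,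
      Subtype.ext (funext hpx)⟩
    rw [Subsingleton.elim (glConj 0 r g X) X]
  obtain ⟨M, S, c, e, hc, -, hsum, hbal⟩ := exists_balanced (r := r) hn
    (f := MvPolynomial.aeval (glCoord n r) p) ⟨p, rfl⟩
  set F : GlTuple n r → ℂ := fun X => ∑ d ∈ S, c d X * ∏ k, (X k).det ^ e d k with hFdef
  have hF : F ∈ coordinateRing (glCoord n r) := by
    have : F = ∑ d ∈ S, c d * ∏ k, (fun X : GlTuple n r => (X k).det) ^ e d k := by
      funext X
      simp [hFdef]
    rw [this]
    exact sum_mem fun d _ => mul_mem (hc d) (prod_mem fun k _ => pow_mem (det_mem n r k).1 _)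
  have hFx : ∀ x, F (toGlTuple x) = f.1 x := by
    intro x
    rw [← hpx, hsum]
    refine Finset.sum_congr rfl fun d _ => ?_
    simp [toGlTuple]
  have hSL : ∀ (g : SpecialLinearGroup (Fin n) ℂ) (X : GlTuple n r),
      F (glConj n r (SpecialLinearGroup.toGL g) X) = F X := by
    intro g X
    -- `F ∘ g - F` is balanced at the same level and vanishes on `SL^r` because `f` is invariant.
    refine sub_eq_zero.mp (((hbal.comp_glConj (SpecialLinearGroup.toGL g)).sub hbal).eq_zero hn
      (sub_mem (comp_glConj_mem_coordinateRing hF _) hF) (fun x => ?_) X)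
    rw [← toGlTuple_slConj]
    rw [hFx, hFx, f.2.2 g x, sub_self]
  refine ⟨⟨F, hF, fun g X => ?_⟩, Subtype.ext (funext hFx)⟩
  -- Scalars act trivially by conjugation, so `SL`-invariance gives `GL`-invariance.
  obtain ⟨t, Y, ht, hY⟩ := exists_smul_specialLinear hn (g : Matrix (Fin n) (Fin n) ℂ)
    ((isUnit_iff_isUnit_det _).mp g.isUnit).ne_zero
  rw [glConj_eq_of_eq_smul (h := SpecialLinearGroup.toGL Y) ht hY, hSL]

end Restriction

end MatrixInvariants

theorem mainTheorem5 (n r : ℕ) :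
    (∃ e : (MatrixInvariants.GlQuotientRing n r ⧸ MatrixInvariants.unimodularIdeal n r) ≃ₐ[ℂ]
        MatrixInvariants.SLQuotientRing n r,
      ∀ (f : MatrixInvariants.GlQuotientRing n r) (x : MatrixInvariants.SLTuple n r),
        (e (Ideal.Quotient.mk (MatrixInvariants.unimodularIdeal n r) f)).1 x =
          f.1 (fun k => (x k : Matrix (Fin n) (Fin n) ℂ))) ∧
    (∀ X : Matrix (Fin n) (Fin n) ℂ,
      MatrixInvariants.newtonP n (MatrixInvariants.powTrace X) =
        (X ^ n).trace + (-1) ^ n * (n : ℂ) * (X.det - 1)) ∧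
    (∀ (X : Matrix (Fin n) (Fin n) ℂ) (k : ℕ), k ≤ n →
      X.charpoly.coeff k =
        (-1) ^ (n - k) * MatrixInvariants.newtonC (MatrixInvariants.powTrace X) (n - k)) ∧
    (∃ Q : MvPolynomial (Fin (n - 1)) ℂ, ∀ X : Matrix (Fin n) (Fin n) ℂ,
      MatrixInvariants.newtonP n (MatrixInvariants.powTrace X) =
        MvPolynomial.eval (fun i : Fin (n - 1) => (X ^ ((i : ℕ) + 1)).trace) Q) ∧
    (∃ Q : MvPolynomial (Fin n) ℂ, ∀ X : Matrix (Fin n) (Fin n) ℂ,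
      MatrixInvariants.newtonP n (MatrixInvariants.powTrace X) =
        MvPolynomial.eval (fun i : Fin n => X.charpoly.coeff (i : ℕ)) Q) := by
  refine ⟨⟨(Ideal.quotientEquivAlgOfEq ℂ (MatrixInvariants.ker_restriction n r).symm).trans
      (Ideal.quotientKerAlgEquivOfSurjective (MatrixInvariants.restriction_surjective n r)),
      fun f x => rfl⟩,
    MatrixInvariants.newtonP_powTrace,
    fun X k hk => MatrixInvariants.charpoly_coeff_eq_newtonC X hk,
    MatrixInvariants.newtonP_polynomial_in_traces n,
    MatrixInvariants.newtonP_polynomial_in_charpoly_coeffs n⟩
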